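/- Let $\mathbb D=\{|z|<1\}$, $\mathbb T=\{|z|=1\}$, and let $m$ be normalized Lebesgue measure on $\mathbb T$. For a continuous function $u:\mathbb D\to\mathbb C$ put $\|u\|_\infty=\sup_{z\in\mathbb D}|u(z)|$ and $\|u\|_1=\sup_{0<\rho<1}\int_{\mathbb T}|u(\rho t)|\,dm(t)$. For $q\in\{1,\infty\}$ let $H^q$ be the set of holomorphic $f:\mathbb D\to\mathbb C$ with $\|f\|_q<\infty$, and let $H^1_0=\{h\in H^1: h(0)=0\}$. For $k\ge 1$ let $\mathcal P_{k-1}$ be the set of complex polynomials of degree at most $k-1$, and let $\mathcal P_{-1}=\{0\}$. For $f\in H^\infty$ and integers $k\ge 0$ write $\widehat f_k=f^{(k)}(0)/k!$, $$E_k(f)_\infty=\inf_{p\in\mathcal P_{k-1}}\|f-p\|_\infty,\qquad \mathcal E_k(f)_1=\inf_{p\in\mathcal P_{k-1},\,h\in H^1_0}\|f-(p+\overline h)\|_1 .$$ (In particular $E_0(f)_\infty=\|f\|_\infty$.) Let $n,N\ge 0$ be integers with $N\ge 2n+1$. Then for every $f\in H^\infty$ $$|\widehat f_n|+\tfrac12\,\mathcal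 E_N(f)_1\le E_n(f)_\infty .$$ The constant $\tfrac12$ cannot be improved: for all such $n,N$ and every real $c>\tfrac12$ there is $f\in H^\infty$ with $|\widehat f_n|+c\,\mathcal E_N(f)_1>E_n(f)_\infty$. -/

import Mathlib

open MeasureTheory
open scoped ENNReal NNReal Real ComplexConjugate

namespace BestApprox

/-- The Hardy norm of a function on the open unit disc, for an exponent `1 ≤ q ≤ ∞`:
`sup_{|z| < 1} |f z|` if `q = ∞`, and the supremum over `0 < ρ < 1` of
`(∫ |f (ρ t)| ^ q dm(t)) ^ (1 / q)` if `q < ∞`, where `m` is the normalized Lebesgue measure on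
the unit circle, parametrized by `t ↦ exp (2 π i t)` on `ℝ / ℤ`. It takes
values in `[0, ∞]` and makes sense for functions that need not be holomorphic; only the values of `f` on the open unit disc matter. -/
noncomputable def hardyNorm (q : ℝ≥0∞) (f : ℂ → ℂ) : ℝ≥0∞ :=
  if q = ∞ then ⨆ z ∈ Metric.ball (0 : ℂ) 1, ‖f z‖ₑ
  else ⨆ ρ ∈ Set.Ioo (0 : ℝ) 1,
    (∫⁻ t : UnitAddCircle, ‖f ((ρ : ℂ) * (AddCircle.toCircle t : ℂ))‖ₑ ^ q.toReal
      ∂AddCircle.haarAddCircle) ^ (1 / q.toReal)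

/-- The Hardy space `H^q`: functions holomorphic in the open unit disc with finite norm. -/
def hardySpace (q : ℝ≥0∞) : Set (ℂ → ℂ) :=
  {f | DifferentiableOn ℂ f (Metric.ball (0 : ℂ) 1) ∧ hardyNorm q f < ∞}

/-- The functions of `H^q` that vanish at the origin. -/
def hardySpaceZero (q : ℝ≥0∞) : Set (ℂ → ℂ) :=
  {h | h ∈ hardySpace q ∧ h 0 = 0}

/-- The `k`-th Taylor coefficient at the origin. -/
noncomputable def taylorCoeff (f : ℂ → ℂ) (k : ℕ) : ℂ :=
  iteratedDeriv k f 0 / (k.factorial : ℂ)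

/-- The best approximation `E_n(f)_q` by polynomials of degree at most `n - 1`
(`Polynomial.degreeLT ℂ n` consists of the polynomials of degree `< n`, so it is `{0}` for
`n = 0`). -/
noncomputable def bestApprox (q : ℝ≥0∞) (n : ℕ) (f : ℂ → ℂ) : ℝ≥0∞ :=
  ⨅ p ∈ Polynomial.degreeLT ℂ n, hardyNorm q (fun z => f z - p.eval z)

/-- The distance in the norm of index `1` from `f` to the sums `p + conj h`, where `p` is a
polynomial of degree at most `k - 1` (`p = 0` for `k = 0`) and `h ∈ H^1` with `h 0 = 0`. -/
noncomputable def coBestApprox (k : ℕ) (f : ℂ → ℂ) : ℝ≥0∞ :=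
  ⨅ p ∈ Polynomial.degreeLT ℂ k, ⨅ h ∈ hardySpaceZero 1,
    hardyNorm 1 (fun z => f z - (p.eval z + conj (h z)))

end BestApprox

namespace BestApprox

/-! Upper bound: let `g = f - q` with `q` of degree below `n` and `|g| ≤ M`, let `a` be the `n`-th
coefficient of `g` (the same as that of `f`), and let `|l| = 1`, `conj l * a = |a|`. On the circle,
`g - 2 M l s^n + l^2 s^(2n) conj g = -2 l s^n (M - Re (conj l * conj s^n * g))`. The last factor is
nonnegative with mean `M - |a|`, so the `L¹` norm is `2 (M - |a|)`. Also `s^(2n) conj g` is a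
polynomial of degree at most `2n` plus the conjugate of a function vanishing at `0`; since `2n < N`,
the left side is an admissible error for `f`. Boundary values are avoided by working with `g (r z)`,
contracting by the Poisson kernel and letting `r → 1` (`lintegral_reflection_le`,
`coBestApprox_le`).

Sharpness: pairing with `conj s^N` bounds the `L¹` distance below by the `N`-th coefficient
(`enorm_le_coBestApprox`). This is applied to `z^n` times a Möbius function of `z^(N - n)` whose
value at `0` is close to `1`. -/

/-! ### Fourier coefficients on circles -/

theorem integral_haarAddCircle_eq_circleAverage (F : ℂ → ℂ) :
    ∫ t : UnitAddCircle, F (AddCircle.toCircle t : ℂ) ∂AddCircle.haarAddCircle =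
      Real.circleAverage F 0 1 := by
  rw [AddCircle.integral_haarAddCircle, Real.circleAverage,
    ← UnitAddCircle.intervalIntegral_preimage 0]
  have h := intervalIntegral.integral_comp_mul_left (a := 0) (b := 1)
    (fun θ : ℝ => F (circleMap 0 1 θ)) (c := 2 * π) (by positivity)
  simp only [mul_zero, mul_one] at h
  rw [← h]
  simp [AddCircle.toCircle_apply_mk, circleMap]

/-- Cauchy's formula: on the unit circle `conj z = 1 / z`, so rescaling to radius `ρ` turns `conj z
^ n` into `(ρ / z) ^ n`. -/
theorem integral_circle_mul_conj_pow {g : ℂ → ℂ}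
    (hg : DifferentiableOn ℂ g (Metric.ball (0 : ℂ) 1)) (n : ℕ) {ρ : ℝ} (h0 : 0 < ρ)
    (h1 : ρ < 1) :
    ∫ t : UnitAddCircle, g (ρ * (AddCircle.toCircle t : ℂ)) *
      conj (AddCircle.toCircle t : ℂ) ^ n ∂AddCircle.haarAddCircle =
      (ρ : ℂ) ^ n * taylorCoeff g n := by
  have hρ : (ρ : ℂ) ≠ 0 := by exact_mod_cast h0.ne'
  have e1 := integral_haarAddCircle_eq_circleAverage
    (fun z => g (ρ * z) * conj z ^ n)
  rw [e1]
  have e2 : Real.circleAverage (fun z => g (ρ * z) * conj z ^ n) 0 1 =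
      Real.circleAverage (fun z => g z * ((ρ : ℂ) / z) ^ n) 0 ρ := by
    rw [Real.circleAverage_eq_circleAverage_zero_one (R := ρ)]
    apply Real.circleAverage_congr_sphere
    intro z hz
    have hz1 : ‖z‖ = 1 := by simpa using hz
    have hz0 : z ≠ 0 := by rintro rfl; simp at hz1
    have : conj z = z⁻¹ := by
      rw [Complex.inv_def, Complex.normSq_eq_norm_sq, hz1]; simp
    simp only [add_zero, this]
    congr 2
    field_simp
  rw [e2, Real.circleAverage_eq_circleIntegral h0.ne']
  have hc := (hg.mono (Metric.closedBall_subset_ball h1)).circleIntegral_one_div_sub_center_pow_smul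
    h0 n
  have e3 : (∮ z in C(0, ρ), (z - 0)⁻¹ • (g z * ((ρ : ℂ) / z) ^ n)) =
      (ρ : ℂ) ^ n * ∮ z in C(0, ρ), (1 / (z - 0) ^ (n + 1)) • g z := by
    rw [← smul_eq_mul, ← circleIntegral.integral_smul]
    congr 1
    funext z
    simp only [smul_eq_mul, sub_zero, pow_succ, div_eq_mul_inv, mul_inv]
    ring
  rw [e3, hc, taylorCoeff]
  have : (2 * π * Complex.I : ℂ) ≠ 0 := Complex.two_pi_I_ne_zero
  simp only [smul_eq_mul]
  field_simp

/-! ### Poisson integrals and `L¹` contraction -/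

/-- Rotation invariance makes the Poisson integral a convolution on the circle group. -/
theorem poissonKernel_mul_circle (w : ℂ) (s : Circle) :
    poissonKernel 0 (w * s) s = poissonKernel 0 w 1 := by
  have : (s : ℂ) - w * s = (1 - w) * s := by ring
  simp [poissonKernel, this, Circle.norm_coe]

theorem poissonKernel_nonneg {w z : ℂ} (h : ‖w‖ ≤ ‖z‖) : 0 ≤ poissonKernel 0 w z := by
  have : ‖w‖ ^ 2 ≤ ‖z‖ ^ 2 := by gcongr
  simp only [poissonKernel, sub_zero]
  exact div_nonneg (by linarith) (by positivity)

theorem continuous_poissonKernel_circle {w : ℂ} (h : ‖w‖ < 1) :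
    Continuous fun s : Circle => poissonKernel 0 (w * s) 1 := by
  simp only [poissonKernel, sub_zero]
  refine Continuous.div (by fun_prop) (by fun_prop) fun s => ?_
  have : ‖w * s‖ < ‖(1 : ℂ)‖ := by simpa [Circle.norm_coe] using h
  have h1 : (1 : ℂ) - w * s ≠ 0 := fun h => by
    rw [← sub_eq_zero.mp h] at this; exact lt_irrefl _ this
  positivity

/-- A function whose values in the disc are the Poisson integrals of its values on the circle has
`L¹` means on smaller circles bounded by the mean on the unit circle. -/
theorem lintegral_circle_le_of_poisson {u : ℂ → ℂ} (hu : Continuous fun s : Circle => u s)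
    (hp : ∀ w ∈ Metric.ball (0 : ℂ) 1,
      Real.circleAverage (poissonKernel 0 w • u) 0 1 = u w)
    {ρ : ℝ} (h0 : 0 < ρ) (h1 : ρ < 1) :
    ∫⁻ t : UnitAddCircle, ‖u (ρ * (AddCircle.toCircle t : ℂ))‖ₑ ∂AddCircle.haarAddCircle ≤
      ∫⁻ t : UnitAddCircle, ‖u (AddCircle.toCircle t : ℂ)‖ₑ ∂AddCircle.haarAddCircle := by
  have hρ : ‖(ρ : ℂ)‖ < 1 := by simpa [abs_of_pos h0] using h1
  set K : UnitAddCircle → ℝ := fun t => poissonKernel 0 (ρ * (AddCircle.toCircle t : ℂ)) 1 with hK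
  have hKc : Continuous K :=
    (continuous_poissonKernel_circle hρ).comp AddCircle.continuous_toCircle
  have hK0 : ∀ t, 0 ≤ K t := fun t => poissonKernel_nonneg (by simpa [Circle.norm_coe] using hρ.le)
  have hKs : ∀ t s : UnitAddCircle,
      poissonKernel 0 (ρ * (AddCircle.toCircle t : ℂ)) (AddCircle.toCircle s) = K (t - s) := by
    intro t s
    rw [hK]
    simp only
    rw [← poissonKernel_mul_circle _ (AddCircle.toCircle s), mul_assoc, ← Circle.coe_mul,
      ← AddCircle.toCircle_add, sub_add_cancel]
  have hmem : ∀ t : UnitAddCircle, (ρ * (AddCircle.toCircle t : ℂ)) ∈ Metric.ball (0 : ℂ) 1 := by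
    intro t; simpa [Circle.norm_coe] using hρ
  have hu' : Continuous fun s : UnitAddCircle => u (AddCircle.toCircle s) :=
    hu.comp AddCircle.continuous_toCircle
  have hrep : ∀ t : UnitAddCircle, u (ρ * (AddCircle.toCircle t : ℂ)) =
      ∫ s : UnitAddCircle, K (t - s) • u (AddCircle.toCircle s) ∂AddCircle.haarAddCircle := by
    intro t
    rw [← hp _ (hmem t), ← integral_haarAddCircle_eq_circleAverage]
    simp only [Pi.smul_apply', hKs]
  -- The kernel is nonnegative and reproduces the constant `1`, so its mass is `1`.
  have hK1 : ∫⁻ s : UnitAddCircle, ‖K s‖ₑ ∂AddCircle.haarAddCircle = 1 := by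
    have hc := (diffContOnCl_const (c := (1 : ℂ)) (s := Metric.ball (0:ℂ) 1)
      (𝕜 := ℂ)).circleAverage_poissonKernel_smul (hmem 0)
    rw [← integral_haarAddCircle_eq_circleAverage] at hc
    simp only [Pi.smul_apply', hKs] at hc
    have e : ∫ s : UnitAddCircle, K s ∂AddCircle.haarAddCircle = 1 := by
      rw [← integral_sub_left_eq_self K AddCircle.haarAddCircle 0]
      apply Complex.ofReal_injective
      simpa [← integral_complex_ofReal] using hc
    have hi : Integrable K AddCircle.haarAddCircle :=
      hKc.integrable_of_hasCompactSupport (HasCompactSupport.of_compactSpace _)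
    have := ofReal_integral_eq_lintegral_ofReal hi (Filter.Eventually.of_forall hK0)
    rw [e] at this
    simp only [Real.enorm_of_nonneg (hK0 _)]
    rw [← this]; simp
  calc ∫⁻ t : UnitAddCircle, ‖u (ρ * (AddCircle.toCircle t : ℂ))‖ₑ ∂AddCircle.haarAddCircle
      ≤ ∫⁻ t : UnitAddCircle, ∫⁻ s : UnitAddCircle,
          ‖K (t - s)‖ₑ * ‖u (AddCircle.toCircle s)‖ₑ ∂AddCircle.haarAddCircle
            ∂AddCircle.haarAddCircle := by
        refine lintegral_mono fun t => ?_
        rw [hrep t]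
        refine (enorm_integral_le_lintegral_enorm _).trans (le_of_eq ?_)
        simp only [enorm_smul]
    _ = ∫⁻ s : UnitAddCircle, ∫⁻ t : UnitAddCircle,
          ‖K (t - s)‖ₑ * ‖u (AddCircle.toCircle s)‖ₑ ∂AddCircle.haarAddCircle
            ∂AddCircle.haarAddCircle := by
        refine lintegral_lintegral_swap (Continuous.aemeasurable ?_)
        have a : Continuous fun p : UnitAddCircle × UnitAddCircle => K (p.1 - p.2) := by fun_prop
        have b : Continuous fun p : UnitAddCircle × UnitAddCircle =>
          u (AddCircle.toCircle p.2) := hu'.comp continuous_snd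
        have : Continuous fun p : UnitAddCircle × UnitAddCircle =>
          ‖K (p.1 - p.2) • u (AddCircle.toCircle p.2)‖ₑ := (a.smul b).enorm
        simpa only [enorm_smul, Function.uncurry_def] using this
    _ = ∫⁻ t : UnitAddCircle, ‖u (AddCircle.toCircle t : ℂ)‖ₑ ∂AddCircle.haarAddCircle := by
        refine lintegral_congr fun s => ?_
        rw [lintegral_mul_const' _ _ enorm_ne_top,
          lintegral_sub_right_eq_self (fun t => ‖K t‖ₑ) s, hK1, one_mul]

theorem circleAverage_poisson_add_conj {A B : ℂ → ℂ}
    (hA : DiffContOnCl ℂ A (Metric.ball (0 : ℂ) 1)) (hB : DiffContOnCl ℂ B (Metric.ball (0 : ℂ) 1))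
    (w : ℂ) (hw : w ∈ Metric.ball (0 : ℂ) 1) :
    Real.circleAverage (poissonKernel 0 w • fun z => A z + conj (B z)) 0 1 =
      A w + conj (B w) := by
  have hi : ∀ C : ℂ → ℂ, DiffContOnCl ℂ C (Metric.ball (0 : ℂ) 1) →
      CircleIntegrable (poissonKernel 0 w • C) 0 1 := by
    intro C hC
    apply ContinuousOn.circleIntegrable zero_le_one
    have := hC.continuousOn_ball.mono Metric.sphere_subset_closedBall
    have hk := continuousOn_herglotzRieszKernel_sphere hw
    rw [abs_one] at hk
    rw [poissonKernel_eq_re_herglotzRieszKernel]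
    exact (Complex.continuous_re.comp_continuousOn hk).smul this
  have h1 := hA.circleAverage_poissonKernel_smul hw
  have h2 := hB.circleAverage_poissonKernel_smul hw
  have h3 : (poissonKernel 0 w • fun z => A z + conj (B z)) =
      (poissonKernel 0 w • A) + ⇑(Complex.conjCLE : ℂ →L[ℝ] ℂ) ∘ (poissonKernel 0 w • B) := by
    funext z; simp
  have hcc : CircleIntegrable (⇑(Complex.conjCLE : ℂ →L[ℝ] ℂ) ∘ (poissonKernel 0 w • B)) 0 1 := by
    have := hi B hB
    unfold CircleIntegrable at this ⊢
    rw [intervalIntegrable_iff] at this ⊢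
    exact (Complex.conjCLE : ℂ →L[ℝ] ℂ).integrable_comp this
  rw [h3, Real.circleAverage_add (hi A hA) hcc,
    (Complex.conjCLE : ℂ →L[ℝ] ℂ).circleAverage_comp_comm (hi B hB), h1, h2]
  simp

/-- Taylor expansion with a bounded holomorphic remainder. -/
theorem exists_taylor_remainder {g : ℂ → ℂ} (hg : DifferentiableOn ℂ g (Metric.ball (0 : ℂ) 1))
    {M : ℝ} (hM : ∀ z ∈ Metric.ball (0 : ℂ) 1, ‖g z‖ ≤ M) (K : ℕ) :
    ∃ (c : ℕ → ℂ) (h : ℂ → ℂ) (C : ℝ), DifferentiableOn ℂ h (Metric.ball (0 : ℂ) 1) ∧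
      (∀ z ∈ Metric.ball (0 : ℂ) 1, ‖h z‖ ≤ C) ∧
      ∀ z, g z = ∑ k ∈ Finset.range K, c k * z ^ k + z ^ K * h z := by
  induction K with
  | zero => exact ⟨0, g, M, hg, hM, by simp⟩
  | succ K ih =>
    obtain ⟨c, h, C, hd, hC, he⟩ := ih
    -- Schwarz's lemma applied to `h - h 0`, which is bounded by `2 * C`.
    refine ⟨fun k => if k = K then h 0 else c k, dslope h 0, 2 * C, ?_, ?_, ?_⟩
    · exact (Complex.differentiableOn_dslope (Metric.ball_mem_nhds 0 one_pos)).2 hd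
    · intro z hz
      have := Complex.norm_dslope_le_div_of_mapsTo_ball (R₂ := 2 * C) hd (fun w hw => ?_) hz
      · simpa using this
      · rw [mem_closedBall_iff_norm]
        linarith [norm_sub_le (h w) (h 0), hC w hw, hC 0 (by simp)]
    · intro z
      have hs : h z = h 0 + z * dslope h 0 z := by
        have := sub_smul_dslope h 0 z
        simp only [sub_zero, smul_eq_mul] at this
        rw [this]; ring
      have hsum : ∑ k ∈ Finset.range K, (if k = K then h 0 else c k) * z ^ k =
          ∑ k ∈ Finset.range K, c k * z ^ k :=
        Finset.sum_congr rfl fun k hk => by rw [if_neg (Finset.mem_range.1 hk).ne]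
      rw [Finset.sum_range_succ, hsum, he z, hs]
      simp only [if_true]
      ring

/-! ### Norms and Taylor coefficients -/

theorem hardyNorm_one (f : ℂ → ℂ) : hardyNorm 1 f = ⨆ ρ ∈ Set.Ioo (0 : ℝ) 1,
    ∫⁻ t : UnitAddCircle, ‖f ((ρ : ℂ) * (AddCircle.toCircle t : ℂ))‖ₑ
      ∂AddCircle.haarAddCircle := by
  simp [hardyNorm]

theorem hardyNorm_top (f : ℂ → ℂ) :
    hardyNorm ∞ f = ⨆ z ∈ Metric.ball (0 : ℂ) 1, ‖f z‖ₑ := by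
  simp [hardyNorm]

theorem mul_circle_mem_ball {ρ : ℝ} (h : ρ ∈ Set.Ioo (0 : ℝ) 1) (s : Circle) :
    (ρ : ℂ) * (s : ℂ) ∈ Metric.ball (0 : ℂ) 1 := by
  simpa [Circle.norm_coe, abs_of_pos h.1] using h.2

theorem continuous_comp_mul_circle {g : ℂ → ℂ} (hg : ContinuousOn g (Metric.ball (0 : ℂ) 1))
    {ρ : ℝ} (h : ρ ∈ Set.Ioo (0 : ℝ) 1) :
    Continuous fun t : UnitAddCircle => g (ρ * (AddCircle.toCircle t : ℂ)) :=
  hg.comp_continuous (continuous_const.mul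
    (continuous_subtype_val.comp AddCircle.continuous_toCircle)) fun _ => mul_circle_mem_ball h _

theorem integrable_of_continuous_circle {E : Type*} [NormedAddCommGroup E]
    {g : UnitAddCircle → E} (hg : Continuous g) :
    Integrable g AddCircle.haarAddCircle :=
  hg.integrable_of_hasCompactSupport (HasCompactSupport.of_compactSpace _)

theorem taylorCoeff_zero (g : ℂ → ℂ) : taylorCoeff g 0 = g 0 := by
  simp [taylorCoeff]

theorem integral_circle {g : ℂ → ℂ} (hg : DifferentiableOn ℂ g (Metric.ball (0 : ℂ) 1))
    {ρ : ℝ} (h : ρ ∈ Set.Ioo (0 : ℝ) 1) :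
    ∫ t : UnitAddCircle, g (ρ * (AddCircle.toCircle t : ℂ)) ∂AddCircle.haarAddCircle = g 0 := by
  simpa [taylorCoeff_zero] using integral_circle_mul_conj_pow hg 0 h.1 h.2

theorem conj_circle_pow_mul (s : Circle) (n : ℕ) : conj (s : ℂ) ^ n * (s : ℂ) ^ n = 1 := by
  rw [← mul_pow, mul_comm, Complex.mul_conj, Complex.normSq_eq_norm_sq, Circle.norm_coe]; simp

theorem taylorCoeff_pow_mul {h : ℂ → ℂ} (hh : DifferentiableOn ℂ h (Metric.ball (0 : ℂ) 1))
    (n : ℕ) : taylorCoeff (fun z => z ^ n * h z) n = h 0 := by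
  have hd : DifferentiableOn ℂ (fun z => z ^ n * h z) (Metric.ball (0 : ℂ) 1) := by fun_prop
  have hρ : (1 / 2 : ℝ) ∈ Set.Ioo (0 : ℝ) 1 := by norm_num
  have e := integral_circle_mul_conj_pow hd n hρ.1 hρ.2
  have e2 : ∀ t : UnitAddCircle, (((1 / 2 : ℝ) : ℂ) * (AddCircle.toCircle t : ℂ)) ^ n *
      h (((1 / 2 : ℝ) : ℂ) * (AddCircle.toCircle t : ℂ)) * conj (AddCircle.toCircle t : ℂ) ^ n =
      ((1 / 2 : ℝ) : ℂ) ^ n * h (((1 / 2 : ℝ) : ℂ) * (AddCircle.toCircle t : ℂ)) := by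
    intro t
    linear_combination ((1 / 2 : ℝ) : ℂ) ^ n * h (((1 / 2 : ℝ) : ℂ) * (AddCircle.toCircle t : ℂ)) *
      conj_circle_pow_mul (AddCircle.toCircle t) n
  simp only [e2] at e
  rw [integral_const_mul, integral_circle hh hρ] at e
  exact (mul_left_cancel₀ (by norm_num) e).symm

theorem taylorCoeff_polynomial {p : Polynomial ℂ} {N : ℕ} (hp : p ∈ Polynomial.degreeLT ℂ N) :
    taylorCoeff (fun z => p.eval z) N = 0 := by
  have h : ∀ k, iteratedDeriv k (fun z => p.eval z) =
      fun z => (Polynomial.derivative^[k] p).eval z := by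
    intro k
    induction k with
    | zero => simp
    | succ k ih =>
      rw [iteratedDeriv_succ, ih, Function.iterate_succ_apply']
      funext z
      exact Polynomial.deriv _
  have h0 : Polynomial.derivative^[N] p = 0 := by
    rcases eq_or_ne p 0 with rfl | h0
    · simp
    · exact Polynomial.iterate_derivative_eq_zero
        ((Polynomial.natDegree_lt_iff_degree_lt h0).2 (Polynomial.mem_degreeLT.1 hp))
  simp [taylorCoeff, h, h0]

theorem monomial_mem_degreeLT {k N : ℕ} (h : k < N) (a : ℂ) :
    Polynomial.monomial k a ∈ Polynomial.degreeLT ℂ N :=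
  Polynomial.mem_degreeLT.2
    ((Polynomial.degree_monomial_le _ _).trans_lt (by exact_mod_cast h))

/-! ### Duality lower bound and sharpness -/

/-- Integration against `conj s ^ N` kills polynomials of degree below `N` and every `conj h`,
leaving `ρ ^ N * H 0`; then `ρ → 1`. -/
theorem enorm_le_coBestApprox {f H : ℂ → ℂ} {P : Polynomial ℂ} {N : ℕ}
    (hH : DifferentiableOn ℂ H (Metric.ball (0 : ℂ) 1)) (hP : P ∈ Polynomial.degreeLT ℂ N)
    (hf : ∀ z ∈ Metric.ball (0 : ℂ) 1, f z = P.eval z + z ^ N * H z) :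
    ‖H 0‖ₑ ≤ coBestApprox N f := by
  refine le_iInf₂ fun p hp => le_iInf₂ fun h hh => ?_
  rw [hardyNorm_one]
  have hlim : Filter.Tendsto (fun ρ : ℝ => ‖(ρ : ℂ) ^ N * H 0‖ₑ) (nhdsWithin 1 (Set.Iio 1))
      (nhds ‖H 0‖ₑ) := by
    have : Continuous fun ρ : ℝ => ‖(ρ : ℂ) ^ N * H 0‖ₑ := by fun_prop
    simpa using (this.tendsto 1).mono_left nhdsWithin_le_nhds
  refine le_of_tendsto hlim ?_
  filter_upwards [Ioo_mem_nhdsLT (zero_lt_one (α := ℝ))] with ρ hρ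
  refine le_trans ?_ (le_iSup₂ ρ hρ)
  have hdP : DifferentiableOn ℂ (fun z => (P - p).eval z) (Metric.ball (0 : ℂ) 1) :=
    (P - p).differentiable.differentiableOn
  have hdH : DifferentiableOn ℂ (fun z => z ^ N * H z) (Metric.ball (0 : ℂ) 1) := by fun_prop
  have hdh := hh.1.1
  have hdh' : DifferentiableOn ℂ (fun z => z ^ N * h z) (Metric.ball (0 : ℂ) 1) := by fun_prop
  have i1 := integral_circle_mul_conj_pow hdP N hρ.1 hρ.2
  rw [taylorCoeff_polynomial (Submodule.sub_mem _ hP hp), mul_zero] at i1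
  have i2 := integral_circle_mul_conj_pow hdH N hρ.1 hρ.2
  rw [taylorCoeff_pow_mul hH] at i2
  -- The pairing with `conj h` is, up to conjugation and a power of `ρ`, the value of `z ^ N * h z`
  -- at `0`; `h 0 = 0` matters only for `N = 0`.
  have i3 := integral_circle hdh' hρ
  simp only [hh.2, mul_zero, mul_pow, mul_assoc] at i3
  rw [integral_const_mul, mul_eq_zero, or_iff_right (by simp [hρ.1.ne'])] at i3
  have i4 : ∫ t : UnitAddCircle, conj (h (ρ * (AddCircle.toCircle t : ℂ))) *
      conj (AddCircle.toCircle t : ℂ) ^ N ∂AddCircle.haarAddCircle = 0 := by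
    have := congrArg conj i3
    rw [← integral_conj, map_zero] at this
    rw [← this]
    congr 1; funext t; simp [mul_comm]
  have ct : Continuous fun t : UnitAddCircle => conj (AddCircle.toCircle t : ℂ) ^ N :=
    (Complex.continuous_conj.comp
      (continuous_subtype_val.comp AddCircle.continuous_toCircle)).pow N
  have j1 := integrable_of_continuous_circle
    ((continuous_comp_mul_circle hdP.continuousOn hρ).mul ct)
  have j2 := integrable_of_continuous_circle
    ((continuous_comp_mul_circle hdH.continuousOn hρ).mul ct)
  have j3 := integrable_of_continuous_circle
    ((Complex.continuous_conj.comp (continuous_comp_mul_circle hdh.continuousOn hρ)).mul ct)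
  have key : ∫ t : UnitAddCircle, (f (ρ * (AddCircle.toCircle t : ℂ)) -
      (p.eval (ρ * (AddCircle.toCircle t : ℂ)) + conj (h (ρ * (AddCircle.toCircle t : ℂ))))) *
      conj (AddCircle.toCircle t : ℂ) ^ N ∂AddCircle.haarAddCircle = (ρ : ℂ) ^ N * H 0 := by
    have := integral_sub (j1.add j2) j3
    have h2 := integral_add j1 j2
    simp only [Pi.add_apply, Pi.mul_apply, Function.comp_apply] at this h2
    rw [h2, i1, i2, i4, zero_add, sub_zero] at this
    rw [← this]
    congr 1; funext t
    rw [hf _ (mul_circle_mem_ball hρ _), Polynomial.eval_sub]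
    ring
  rw [← key]
  refine (enorm_integral_le_lintegral_enorm _).trans (le_of_eq ?_)
  refine lintegral_congr fun t => ?_
  rw [enorm_mul, enorm_pow, ← ofReal_norm (conj _), Complex.norm_conj, Circle.norm_coe]
  simp

theorem norm_sub_le_norm_one_sub_mul {r : ℝ} (h0 : 0 < r) (h1 : r < 1) {w : ℂ} (hw : ‖w‖ ≤ 1) :
    ‖(r : ℂ) - w‖ ≤ ‖1 - r * w‖ := by
  rw [← sq_le_sq₀ (norm_nonneg _) (norm_nonneg _), Complex.sq_norm, Complex.sq_norm]
  have h : w.re * w.re + w.im * w.im ≤ 1 := by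
    rw [← Complex.normSq_apply, Complex.normSq_eq_norm_sq]
    exact pow_le_one₀ (norm_nonneg _) hw
  simp only [Complex.normSq_apply, Complex.sub_re, Complex.sub_im, Complex.mul_re, Complex.mul_im,
    Complex.ofReal_re, Complex.ofReal_im, Complex.one_re, Complex.one_im]
  have : 0 ≤ (1 - r ^ 2) * (1 - (w.re * w.re + w.im * w.im)) :=
    mul_nonneg (by nlinarith) (by linarith)
  nlinarith

theorem exists_bestApprox_lt (n m : ℕ) (hm : 0 < m) (c : ℝ≥0) (hc : 1 / 2 < c) :
    ∃ f ∈ hardySpace ∞, bestApprox ∞ n f <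
      ‖taylorCoeff f n‖ₑ + (c : ℝ≥0∞) * coBestApprox (n + m) f := by
  have hc' : (1 / 2 : ℝ) < c := by exact_mod_cast hc
  -- Since `r + c (1 - r^2) - 1 = (1 - r) (c (1 + r) - 1)`, the condition needed is `1 / c - 1 < r <
  -- 1`.
  obtain ⟨r, hr, hr1⟩ := exists_between (max_lt (zero_lt_one (α := ℝ))
    (show 1 / (c : ℝ) - 1 < 1 by
      rw [sub_lt_iff_lt_add, div_lt_iff₀ (by linarith)]; linarith))
  obtain ⟨h0, hrc⟩ := max_lt_iff.1 hr
  rw [sub_lt_iff_lt_add, div_lt_iff₀ (by linarith)] at hrc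
  have hne : ∀ z ∈ Metric.ball (0 : ℂ) 1, 1 - r * z ^ m ≠ 0 := by
    intro z hz h
    have h2 : ‖z ^ m‖ ≤ 1 := by
      rw [norm_pow]; exact pow_le_one₀ (norm_nonneg _) (mem_ball_zero_iff.1 hz).le
    have h3 : ‖(r : ℂ) * z ^ m‖ < 1 := by
      rw [norm_mul, Complex.norm_real, Real.norm_of_nonneg h0.le]
      nlinarith
    rw [← sub_eq_zero.1 h] at h3
    simp at h3
  set G : ℂ → ℂ := fun z => (r - z ^ m) / (1 - r * z ^ m) with hG
  have hdG : DifferentiableOn ℂ G (Metric.ball (0 : ℂ) 1) :=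
    DifferentiableOn.div (by fun_prop) (by fun_prop) hne
  have hdH : DifferentiableOn ℂ (fun z : ℂ => -(1 - (r : ℂ) ^ 2) / (1 - r * z ^ m))
      (Metric.ball (0 : ℂ) 1) :=
    DifferentiableOn.div (by fun_prop) (by fun_prop) hne
  have hle : hardyNorm ∞ (fun z => z ^ n * G z) ≤ 1 := by
    rw [hardyNorm_top]
    refine iSup₂_le fun z hz => ?_
    have hz' : ‖z‖ ≤ 1 := (mem_ball_zero_iff.1 hz).le
    have hG1 : ‖G z‖ ≤ 1 := by
      rw [hG, norm_div]
      exact div_le_one_of_le₀ (norm_sub_le_norm_one_sub_mul h0 hr1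
        (by rw [norm_pow]; exact pow_le_one₀ (norm_nonneg _) hz')) (norm_nonneg _)
    rw [← ofReal_norm, ← ENNReal.ofReal_one]
    apply ENNReal.ofReal_le_ofReal
    rw [norm_mul, norm_pow]
    exact mul_le_one₀ (pow_le_one₀ (norm_nonneg _) hz') (norm_nonneg _) hG1
  refine ⟨fun z => z ^ n * G z, ⟨by fun_prop, hle.trans_lt ENNReal.one_lt_top⟩, ?_⟩
  have hb : bestApprox ∞ n (fun z => z ^ n * G z) ≤ 1 :=
    (iInf₂_le 0 (Submodule.zero_mem _)).trans (by simpa using hle)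
  -- With `w = z ^ m`, `(r - w) / (1 - r w) = r - (1 - r^2) w / (1 - r w)`.
  have hco := enorm_le_coBestApprox (f := fun z => z ^ n * G z) (N := n + m)
    (P := Polynomial.monomial n (r : ℂ)) hdH
    (monomial_mem_degreeLT (Nat.lt_add_of_pos_right hm) _) fun z hz => by
        have := hne z hz
        simp only [hG, Polynomial.eval_monomial]
        field_simp
        ring
  rw [taylorCoeff_pow_mul hdG]
  have e1 : ‖G 0‖ₑ = ENNReal.ofReal r := by
    simp [hG, hm.ne', ← ofReal_norm, abs_of_pos h0]
  have hr2 : 0 ≤ 1 - r ^ 2 := by nlinarith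
  have e2 : ‖-(1 - (r : ℂ) ^ 2) / (1 - r * 0 ^ m)‖ₑ = ENNReal.ofReal (1 - r ^ 2) := by
    rw [zero_pow hm.ne', mul_zero, sub_zero, div_one, enorm_neg, ← ofReal_norm]
    congr 1
    have : (1 - (r : ℂ) ^ 2) = ((1 - r ^ 2 : ℝ) : ℂ) := by push_cast; rfl
    rw [this, Complex.norm_real, Real.norm_of_nonneg hr2]
  rw [e2] at hco
  rw [e1]
  refine hb.trans_lt (lt_of_lt_of_le ?_ (add_le_add_right (mul_le_mul_right hco _) _))
  rw [← ENNReal.ofReal_coe_nnreal, ← ENNReal.ofReal_mul c.coe_nonneg, ← ENNReal.ofReal_add h0.le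
    (mul_nonneg c.coe_nonneg hr2), ← ENNReal.ofReal_one]
  refine (ENNReal.ofReal_lt_ofReal_iff_of_nonneg zero_le_one).2 ?_
  nlinarith

/-! ### Reflection and the upper bound -/

theorem exists_phase (a : ℂ) : ∃ l : ℂ, ‖l‖ = 1 ∧ conj l * a = ‖a‖ := by
  rcases eq_or_ne a 0 with rfl | ha
  · exact ⟨1, by simp⟩
  · have h : (‖a‖ : ℂ) ≠ 0 := by simpa using ha
    refine ⟨a / ‖a‖, by simp [ha], ?_⟩
    rw [map_div₀, Complex.conj_ofReal, div_mul_eq_mul_div, mul_comm, Complex.mul_conj,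
      Complex.normSq_eq_norm_sq]
    push_cast
    field_simp

/-- The harmonic extension to the disc of `s ↦ s ^ (2 * n) * conj (g (r * s))`, where
`g z = ∑ k < 2 * n + 1, c k * z ^ k + z ^ (2 * n + 1) * h z`. -/
noncomputable def reflectedSum (c : ℕ → ℂ) (h : ℂ → ℂ) (n : ℕ) (r : ℝ) (z : ℂ) : ℂ :=
  ∑ k ∈ Finset.range (2 * n + 1), conj (c k) * r ^ k * z ^ (2 * n - k) +
    conj ((r : ℂ) ^ (2 * n + 1) * z * h (r * z))

/-- Since `conj s = 1 / s`, terms with `k ≤ 2n` become `s ^ (2n - k)`; the cut at `2n + 1` leaves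
one spare `conj s` in the remainder, so that its conjugate vanishes at `0`. -/
theorem reflectedSum_circle {c : ℕ → ℂ} {g h : ℂ → ℂ} {n : ℕ}
    (hg : ∀ z, g z = ∑ k ∈ Finset.range (2 * n + 1), c k * z ^ k + z ^ (2 * n + 1) * h z)
    (r : ℝ) (s : Circle) :
    reflectedSum c h n r s = (s : ℂ) ^ (2 * n) * conj (g (r * s)) := by
  have hs : conj (s : ℂ) * (s : ℂ) = 1 := by simpa using conj_circle_pow_mul s 1
  rw [hg, reflectedSum]
  simp only [map_add, map_sum, map_mul, map_pow, Complex.conj_ofReal, mul_add, Finset.mul_sum,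
    mul_pow]
  congr 1
  · refine Finset.sum_congr rfl fun k hk => ?_
    have hk' : 2 * n = (2 * n - k) + k := by have := Finset.mem_range.1 hk; omega
    conv_rhs => rw [hk', pow_add]
    linear_combination -(conj (c k) * r ^ k * (s : ℂ) ^ (2 * n - k)) * conj_circle_pow_mul s k
  · linear_combination -((r : ℂ) ^ (2 * n + 1) * conj (s : ℂ) * conj (h (r * s))) *
      conj_circle_pow_mul s (2 * n)

theorem lintegral_reflection_le {c : ℕ → ℂ} {g h : ℂ → ℂ} {n : ℕ}
    (hdg : DifferentiableOn ℂ g (Metric.ball (0 : ℂ) 1))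
    (hdh : DifferentiableOn ℂ h (Metric.ball (0 : ℂ) 1))
    (hg : ∀ z, g z = ∑ k ∈ Finset.range (2 * n + 1), c k * z ^ k + z ^ (2 * n + 1) * h z)
    {M : ℝ} (hM : ∀ z ∈ Metric.ball (0 : ℂ) 1, ‖g z‖ ≤ M) {l : ℂ} (hl : ‖l‖ = 1)
    (hla : conj l * taylorCoeff g n = ‖taylorCoeff g n‖)
    {r ρ : ℝ} (hr : r ∈ Set.Ioo (0 : ℝ) 1) (hρ : ρ ∈ Set.Ioo (0 : ℝ) 1) :
    ∫⁻ t : UnitAddCircle, ‖g (r * (ρ * (AddCircle.toCircle t : ℂ))) -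
        2 * M * l * (ρ * (AddCircle.toCircle t : ℂ)) ^ n +
        l ^ 2 * reflectedSum c h n r (ρ * (AddCircle.toCircle t : ℂ))‖ₑ
          ∂AddCircle.haarAddCircle ≤
      ENNReal.ofReal (2 * (M - r ^ n * ‖taylorCoeff g n‖)) := by
  have hmaps : Set.MapsTo (fun z : ℂ => r * z) (closure (Metric.ball (0 : ℂ) 1))
      (Metric.ball (0 : ℂ) 1) := by
    intro z hz
    rw [closure_ball _ one_ne_zero, mem_closedBall_zero_iff] at hz
    rw [mem_ball_zero_iff, norm_mul, Complex.norm_real, Real.norm_of_nonneg hr.1.le]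
    nlinarith [hr.1, hr.2]
  have hgr : DifferentiableOn ℂ (fun z => g (r * z)) (closure (Metric.ball (0 : ℂ) 1)) :=
    hdg.comp (by fun_prop) hmaps
  have hhr : DifferentiableOn ℂ (fun z => h (r * z)) (closure (Metric.ball (0 : ℂ) 1)) :=
    hdh.comp (by fun_prop) hmaps
  have hA : DiffContOnCl ℂ (fun z => g (r * z) - 2 * M * l * z ^ n +
      l ^ 2 * ∑ k ∈ Finset.range (2 * n + 1), conj (c k) * r ^ k * z ^ (2 * n - k))
      (Metric.ball (0 : ℂ) 1) := by
    apply DifferentiableOn.diffContOnCl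
    fun_prop
  have hB : DiffContOnCl ℂ (fun z => conj (l ^ 2) * ((r : ℂ) ^ (2 * n + 1) * z * h (r * z)))
      (Metric.ball (0 : ℂ) 1) := by
    apply DifferentiableOn.diffContOnCl
    fun_prop
  have hu : ∀ z, g (r * z) - 2 * M * l * z ^ n + l ^ 2 * reflectedSum c h n r z =
      (g (r * z) - 2 * M * l * z ^ n +
      l ^ 2 * ∑ k ∈ Finset.range (2 * n + 1), conj (c k) * r ^ k * z ^ (2 * n - k)) +
      conj (conj (l ^ 2) * ((r : ℂ) ^ (2 * n + 1) * z * h (r * z))) := by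
    intro z
    rw [reflectedSum, map_mul conj (conj (l ^ 2)), Complex.conj_conj]
    ring
  have hcg : Continuous fun s : Circle => g (r * s) :=
    hdg.continuousOn.comp_continuous (by fun_prop) fun s => mul_circle_mem_ball hr s
  have hcu : Continuous fun s : Circle => g (r * s) - 2 * M * l * (s : ℂ) ^ n +
      l ^ 2 * reflectedSum c h n r s := by
    simp only [reflectedSum_circle hg]
    have hcs : Continuous fun s : Circle => (s : ℂ) := continuous_subtype_val
    exact (hcg.sub (continuous_const.mul (hcs.pow n))).add (continuous_const.mul
      ((hcs.pow (2 * n)).mul (Complex.continuous_conj.comp hcg)))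
  have hcon := lintegral_circle_le_of_poisson
    (u := fun z => g (r * z) - 2 * M * l * z ^ n + l ^ 2 * reflectedSum c h n r z) hcu
    (by simp only [hu]; exact circleAverage_poisson_add_conj hA hB) hρ.1 hρ.2
  refine hcon.trans (le_of_eq ?_)
  -- The integrand on the circle has modulus `2 (M - Re G)`, and the mean of `G` is `r ^ n` times
  -- the modulus of the coefficient.
  set G : UnitAddCircle → ℂ := fun t =>
    conj l * (g (r * (AddCircle.toCircle t : ℂ)) * conj (AddCircle.toCircle t : ℂ) ^ n) with hG
  have hll : conj l * l = 1 := by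
    rw [mul_comm, Complex.mul_conj, Complex.normSq_eq_norm_sq, hl]; simp
  have hGM : ∀ t, (G t).re ≤ M := by
    intro t
    refine (Complex.re_le_norm _).trans ?_
    simpa [hG, hl, Circle.norm_coe] using hM _ (mul_circle_mem_ball hr _)
  have hGc : Continuous G :=
    continuous_const.mul ((hcg.comp AddCircle.continuous_toCircle).mul
      ((Complex.continuous_conj.comp
        (continuous_subtype_val.comp AddCircle.continuous_toCircle)).pow n))
  have hGi : ∫ t, G t ∂AddCircle.haarAddCircle = (r : ℂ) ^ n * ‖taylorCoeff g n‖ := by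
    rw [hG, integral_const_mul, integral_circle_mul_conj_pow hdg n hr.1 hr.2, ← hla]
    ring
  have hGre : ∫ t, (G t).re ∂AddCircle.haarAddCircle = r ^ n * ‖taylorCoeff g n‖ := by
    have := integral_re (𝕜 := ℂ) (integrable_of_continuous_circle hGc)
    rw [hGi] at this
    refine this.trans ?_
    rw [← Complex.ofReal_pow, ← Complex.ofReal_mul]
    exact Complex.ofReal_re _
  have hpt : ∀ t : UnitAddCircle, ‖g (r * (AddCircle.toCircle t : ℂ)) -
      2 * M * l * (AddCircle.toCircle t : ℂ) ^ n +
      l ^ 2 * reflectedSum c h n r (AddCircle.toCircle t)‖ₑ =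
      ENNReal.ofReal (2 * (M - (G t).re)) := by
    intro t
    have hs := conj_circle_pow_mul (AddCircle.toCircle t) n
    have e : g (r * (AddCircle.toCircle t : ℂ)) -
        2 * M * l * (AddCircle.toCircle t : ℂ) ^ n +
        l ^ 2 * reflectedSum c h n r (AddCircle.toCircle t) =
        -(l * (AddCircle.toCircle t : ℂ) ^ n) * (2 * M - (G t + conj (G t))) := by
      rw [reflectedSum_circle hg, hG]
      simp only [map_mul, map_pow, Complex.conj_conj]
      linear_combination -(g (r * (AddCircle.toCircle t : ℂ)) * hs) -
        g (r * (AddCircle.toCircle t : ℂ)) * conj (AddCircle.toCircle t : ℂ) ^ n *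
          (AddCircle.toCircle t : ℂ) ^ n * hll
    have e2 : (2 * M - (G t + conj (G t)) : ℂ) = ((2 * (M - (G t).re) : ℝ) : ℂ) := by
      rw [Complex.add_conj]; push_cast; ring
    rw [e, e2, ← ofReal_norm]
    congr 1
    rw [norm_mul, norm_neg, norm_mul, norm_pow, hl, Circle.norm_coe, one_pow, one_mul, one_mul,
      Complex.norm_real, Real.norm_of_nonneg (by linarith [hGM t])]
  simp only [hpt]
  have hre : Continuous fun t => (G t).re := Complex.continuous_re.comp hGc
  have hi : Integrable (fun t => 2 * (M - (G t).re)) AddCircle.haarAddCircle :=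
    integrable_of_continuous_circle (continuous_const.mul (continuous_const.sub hre))
  rw [← ofReal_integral_eq_lintegral_ofReal hi
    (Filter.Eventually.of_forall fun t => by
      simp only [Pi.zero_apply]; linarith [hGM t]),
    integral_const_mul, integral_sub (integrable_const _) (integrable_of_continuous_circle hre),
    hGre]
  simp

theorem coBestApprox_le {f g : ℂ → ℂ} {n N : ℕ} (hN : 2 * n + 1 ≤ N)
    {q : Polynomial ℂ} (hq : q ∈ Polynomial.degreeLT ℂ n) (hf : ∀ z, f z = g z + q.eval z)
    (hdg : DifferentiableOn ℂ g (Metric.ball (0 : ℂ) 1))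
    {M : ℝ} (hM : ∀ z ∈ Metric.ball (0 : ℂ) 1, ‖g z‖ ≤ M) :
    coBestApprox N f ≤ ENNReal.ofReal (2 * (M - ‖taylorCoeff g n‖)) := by
  obtain ⟨c, h, C, hdh, hC, hg⟩ := exists_taylor_remainder hdg hM (2 * n + 1)
  obtain ⟨l, hl, hla⟩ := exists_phase (taylorCoeff g n)
  -- `p` and `H` are chosen so that `f - (p + conj H)` is the reflected expression with `r = 1`.
  set p : Polynomial ℂ := q + Polynomial.monomial n (2 * M * l) -
    ∑ k ∈ Finset.range (2 * n + 1), Polynomial.monomial (2 * n - k) (l ^ 2 * conj (c k)) with hp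
  have hpN : p ∈ Polynomial.degreeLT ℂ N := by
    refine Submodule.sub_mem _ (Submodule.add_mem _ ?_ (monomial_mem_degreeLT (by omega) _))
      (Submodule.sum_mem _ fun k _ => monomial_mem_degreeLT (by omega) _)
    exact Polynomial.degreeLT_mono (by omega) hq
  set H : ℂ → ℂ := fun z => -(conj (l ^ 2) * (z * h z)) with hH
  have hHC : ∀ z ∈ Metric.ball (0 : ℂ) 1, ‖H z‖ ≤ C := by
    intro z hz
    have hz' : ‖z‖ ≤ 1 := (mem_ball_zero_iff.1 hz).le
    simp only [hH, norm_neg, norm_mul, Complex.norm_conj, norm_pow, hl, one_pow, one_mul]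
    nlinarith [hC z hz, norm_nonneg (h z)]
  have hHmem : H ∈ hardySpaceZero 1 := by
    refine ⟨⟨by fun_prop, ?_⟩, by simp [hH]⟩
    rw [hardyNorm_one]
    refine lt_of_le_of_lt (iSup₂_le fun ρ hρ => ?_) (ENNReal.ofReal_lt_top (r := C))
    refine (lintegral_mono fun t => ?_).trans_eq (b := ∫⁻ _ : UnitAddCircle, ENNReal.ofReal C
      ∂AddCircle.haarAddCircle) (by simp)
    rw [← ofReal_norm]
    exact ENNReal.ofReal_le_ofReal (hHC _ (mul_circle_mem_ball hρ _))
  refine (iInf₂_le p hpN).trans ((iInf₂_le H hHmem).trans ?_)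
  have hu : ∀ z, f z - (p.eval z + conj (H z)) = g z - 2 * M * l * z ^ n +
      l ^ 2 * reflectedSum c h n 1 z := by
    intro z
    simp only [hf, hp, hH, reflectedSum, Polynomial.eval_sub, Polynomial.eval_add,
      Polynomial.eval_monomial, Polynomial.eval_finsetSum, mul_add, Finset.mul_sum,
      Complex.ofReal_one, one_pow, mul_one, one_mul, map_neg, map_mul, map_pow,
      Complex.conj_conj, mul_assoc]
    ring
  simp only [hu]
  rw [hardyNorm_one]
  refine iSup₂_le fun ρ hρ => ?_
  obtain ⟨r, -, hr, hrt⟩ := exists_seq_strictMono_tendsto' (zero_lt_one (α := ℝ))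
  have hrC : Filter.Tendsto (fun j => (r j : ℂ)) Filter.atTop (nhds 1) := by
    have := (Complex.continuous_ofReal.tendsto 1).comp hrt
    simpa [Function.comp_def] using this
  have hscale : ∀ {F : ℂ → ℂ} (_ : DifferentiableOn ℂ F (Metric.ball (0 : ℂ) 1)) (z : ℂ)
      (_ : z ∈ Metric.ball (0 : ℂ) 1),
      Filter.Tendsto (fun j => F (r j * z)) Filter.atTop (nhds (F z)) := by
    intro F hF z hz
    have := (hF.continuousOn.continuousAt (Metric.isOpen_ball.mem_nhds hz)).tendsto
    refine this.comp ?_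
    simpa using hrC.mul_const z
  have hlim : ∀ z ∈ Metric.ball (0 : ℂ) 1, Filter.Tendsto
      (fun j => ‖g (r j * z) - 2 * M * l * z ^ n + l ^ 2 * reflectedSum c h n (r j) z‖ₑ)
      Filter.atTop (nhds ‖g z - 2 * M * l * z ^ n + l ^ 2 * reflectedSum c h n 1 z‖ₑ) := by
    intro z hz
    refine (continuous_enorm.tendsto _).comp ?_
    refine ((hscale hdg z hz).sub_const _).add (Filter.Tendsto.const_mul _ ?_)
    refine Filter.Tendsto.add (tendsto_finsetSum _ fun k _ => ?_) ?_
    · simpa using ((hrC.pow k).const_mul (conj (c k))).mul_const (z ^ (2 * n - k))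
    · refine (Complex.continuous_conj.tendsto _).comp ?_
      simpa using ((hrC.pow (2 * n + 1)).mul_const z).mul (hscale hdh z hz)
  have hmeas : ∀ j, Measurable fun t : UnitAddCircle =>
      ‖g (r j * (ρ * (AddCircle.toCircle t : ℂ))) -
        2 * M * l * (ρ * (AddCircle.toCircle t : ℂ)) ^ n +
        l ^ 2 * reflectedSum c h n (r j) (ρ * (AddCircle.toCircle t : ℂ))‖ₑ := by
    intro j
    refine Continuous.measurable (Continuous.enorm ?_)
    have hmaps : Set.MapsTo (fun z : ℂ => r j * z) (Metric.ball (0 : ℂ) 1)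
        (Metric.ball (0 : ℂ) 1) := by
      intro z hz
      rw [mem_ball_zero_iff] at hz ⊢
      rw [norm_mul, Complex.norm_real, Real.norm_of_nonneg (hr j).1.le]
      nlinarith [(hr j).1, (hr j).2, norm_nonneg z]
    have h1 : ContinuousOn (fun z => g (r j * z)) (Metric.ball (0 : ℂ) 1) :=
      hdg.continuousOn.comp (by fun_prop) hmaps
    have h2 : ContinuousOn (fun z => h (r j * z)) (Metric.ball (0 : ℂ) 1) :=
      hdh.continuousOn.comp (by fun_prop) hmaps
    refine continuous_comp_mul_circle (g := fun z => g (r j * z) - 2 * M * l * z ^ n +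
      l ^ 2 * reflectedSum c h n (r j) z) ?_ hρ
    simp only [reflectedSum]
    refine (h1.sub (by fun_prop)).add (continuousOn_const.mul (ContinuousOn.add (by fun_prop) ?_))
    exact Complex.continuous_conj.comp_continuousOn ((ContinuousOn.mul (by fun_prop) h2))
  have hbound : Filter.Tendsto
      (fun j => ENNReal.ofReal (2 * (M - r j ^ n * ‖taylorCoeff g n‖))) Filter.atTop
      (nhds (ENNReal.ofReal (2 * (M - ‖taylorCoeff g n‖)))) := by
    refine (ENNReal.continuous_ofReal.tendsto _).comp ?_
    simpa using (((hrt.pow n).mul_const ‖taylorCoeff g n‖).const_sub M).const_mul 2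
  -- Fatou's lemma on the fixed circle of radius `ρ`, as `r j → 1`.
  calc _ = ∫⁻ t : UnitAddCircle, Filter.liminf (fun j =>
      ‖g (r j * (ρ * (AddCircle.toCircle t : ℂ))) -
        2 * M * l * (ρ * (AddCircle.toCircle t : ℂ)) ^ n +
        l ^ 2 * reflectedSum c h n (r j) (ρ * (AddCircle.toCircle t : ℂ))‖ₑ) Filter.atTop
          ∂AddCircle.haarAddCircle :=
        lintegral_congr fun t => (hlim _ (mul_circle_mem_ball hρ _)).liminf_eq.symm
    _ ≤ _ := lintegral_liminf_le hmeas
    _ ≤ _ := Filter.liminf_le_liminf (Filter.Eventually.of_forall fun j =>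
        lintegral_reflection_le hdg hdh hg hM hl hla (hr j) hρ)
    _ = _ := hbound.liminf_eq

theorem taylorCoeff_sub_polynomial {f : ℂ → ℂ}
    (hf : DifferentiableOn ℂ f (Metric.ball (0 : ℂ) 1)) {n : ℕ} {p : Polynomial ℂ}
    (hp : p ∈ Polynomial.degreeLT ℂ n) :
    taylorCoeff (fun z => f z - p.eval z) n = taylorCoeff f n := by
  have hfa : ContDiffAt ℂ n f 0 :=
    (hf.analyticAt (Metric.ball_mem_nhds 0 one_pos)).contDiffAt
  have hpa : ContDiffAt ℂ n (fun z => p.eval z) 0 := by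
    simpa using (p.contDiff_aeval (𝕜 := ℂ) n).contDiffAt
  have hp0 := taylorCoeff_polynomial hp
  unfold taylorCoeff at hp0 ⊢
  rw [iteratedDeriv_fun_sub hfa hpa, sub_div, hp0, sub_zero]

theorem enorm_taylorCoeff_add_le {n N : ℕ} (hN : 2 * n + 1 ≤ N) {f : ℂ → ℂ}
    (hf : f ∈ hardySpace ∞) :
    ‖taylorCoeff f n‖ₑ + (1 / 2) * coBestApprox N f ≤ bestApprox ∞ n f := by
  refine le_iInf₂ fun p hp => ?_
  set g : ℂ → ℂ := fun z => f z - p.eval z with hgdef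
  rcases eq_or_ne (hardyNorm ∞ g) ∞ with htop | htop
  · rw [htop]; exact le_top
  have hdg : DifferentiableOn ℂ g (Metric.ball (0 : ℂ) 1) :=
    hf.1.sub p.differentiable.differentiableOn
  set M := (hardyNorm ∞ g).toReal with hMdef
  have hM : ∀ z ∈ Metric.ball (0 : ℂ) 1, ‖g z‖ ≤ M := by
    intro z hz
    have h1 : ‖g z‖ₑ ≤ hardyNorm ∞ g := by
      rw [hardyNorm_top]; exact le_iSup₂ (f := fun z _ => ‖g z‖ₑ) z hz
    rw [← toReal_enorm]
    exact ENNReal.toReal_mono htop h1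
  have hM0 : ENNReal.ofReal M = hardyNorm ∞ g := ENNReal.ofReal_toReal htop
  have hle := coBestApprox_le hN hp (f := f) (g := g) (fun z => by simp [hgdef]) hdg hM
  rw [← taylorCoeff_sub_polynomial hf.1 hp, ← hM0]
  -- Ensures that `ENNReal.ofReal` does not truncate `M - ‖taylorCoeff g n‖`.
  have ha : ‖taylorCoeff g n‖ ≤ M := by
    have hlim : Filter.Tendsto (fun ρ : ℝ => ρ ^ n * ‖taylorCoeff g n‖)
        (nhdsWithin 1 (Set.Iio 1)) (nhds ‖taylorCoeff g n‖) := by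
      have : Continuous fun ρ : ℝ => ρ ^ n * ‖taylorCoeff g n‖ := by fun_prop
      simpa using (this.tendsto 1).mono_left nhdsWithin_le_nhds
    refine le_of_tendsto hlim ?_
    filter_upwards [Ioo_mem_nhdsLT (zero_lt_one (α := ℝ))] with ρ hρ
    have e := congrArg norm (integral_circle_mul_conj_pow hdg n hρ.1 hρ.2)
    rw [norm_mul, norm_pow, Complex.norm_real, Real.norm_of_nonneg hρ.1.le] at e
    rw [← e]
    refine (norm_integral_le_of_norm_le_const (C := M)
      (Filter.Eventually.of_forall fun t => ?_)).trans_eq (by simp)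
    simpa [Circle.norm_coe] using hM _ (mul_circle_mem_ball hρ _)
  calc ‖taylorCoeff g n‖ₑ + (1 / 2) * coBestApprox N f
      ≤ ENNReal.ofReal ‖taylorCoeff g n‖ +
        ENNReal.ofReal (1 / 2) * ENNReal.ofReal (2 * (M - ‖taylorCoeff g n‖)) := by
        rw [ofReal_norm]
        gcongr
        simp
    _ = ENNReal.ofReal M := by
        rw [← ENNReal.ofReal_mul (by norm_num), ← ENNReal.ofReal_add (norm_nonneg _)
          (by linarith)]
        congr 1; ring

end BestApprox

theorem mainTheorem4 (n N : ℕ) (hN : 2 * n + 1 ≤ N) :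
    (∀ f ∈ BestApprox.hardySpace ∞,
      ‖BestApprox.taylorCoeff f n‖ₑ + (1 / 2) * BestApprox.coBestApprox N f
        ≤ BestApprox.bestApprox ∞ n f) ∧
    (∀ c : ℝ≥0, 1 / 2 < c →
      ∃ f ∈ BestApprox.hardySpace ∞,
        BestApprox.bestApprox ∞ n f
          < ‖BestApprox.taylorCoeff f n‖ₑ + (c : ℝ≥0∞) * BestApprox.coBestApprox N f) := by
  refine ⟨fun f hf => BestApprox.enorm_taylorCoeff_add_le hN hf, fun c hc => ?_⟩
  obtain ⟨m, rfl⟩ := Nat.exists_eq_add_of_le (show n ≤ N by omega)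
  exact BestApprox.exists_bestApprox_lt n m (by omega) c hc
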